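/- Let $m\ge 0$. Write $B(x,R)$ for open balls in $\mathbb R^m$. A function $\phi:\mathbb R^m\to\mathbb R$ is locally semiconcave (with linear modulus) if for every $R>0$ it is continuous on $B(0,R)$ and there is $C\ge 0$ such that for every $x\in B(0,R)$ there is $p\in\mathbb R^m$ with $\phi(y)\le\phi(x)+\langle p,y-x\rangle+\frac C2|x-y|^2$ for all $y\in B(0,R)$. Its proximal superdifferential $D^+\phi(x)$ is the set of all $p\in\mathbb R^m$ for which there are $C\ge 0$ and $r>0$ such that this inequality holds for all $y\in B(x,r)$, and $\operatorname{Sing}(\phi)$ is the set of those $x$ for which $D^+\phi(x)$ is not a singleton. Let $\mathscr P_c(\mathbb R^m)$ be the set of Borel probability measures on $\mathbb R^m$ with compact support. For $\mu,\nu\in\mathscr P_c(\mathbb R^m)$ let $\Gamma(\mu,\nu)$ be the set of Borel measures on $\mathbb R^m\times\mathbb R^m$ with marginals $\mu$ and $\nu$, let $W_2(\mu,\nu)=\big(\inf_{\gamma\in\Gamma(\mu,\nu)}\int|x-y|^2\,d\gamma\big)^{1/2}$, and let $\Gamma_2(\mu,\nu)$ be the set of minimizers. For $R>0$ let $B_R(\mu)=\bigcup_{x\in\operatorname{supp}\mu}B(x,R)$.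 For $U:\mathscr P_c(\mathbb R^m)\to\mathbb R$ and $\mu\in\mathscr P_c(\mathbb R^m)$, the localized Fréchet superdifferential $\partial^+U(\mu)$ is the set of $\alpha\in L^2(\mathbb R^m,\mu;\mathbb R^m)$ such that for every $R>0$ $$U(\nu)-U(\mu)\le\sup_{\gamma\in\Gamma_2(\mu,\nu)}\int\langle\alpha(x),y-x\rangle\,d\gamma(x,y)+o_R(W_2(\mu,\nu))$$ for probability measures $\nu$ concentrated on $B_R(\mu)$, i.e. for all $R,\varepsilon>0$ there is $\delta>0$ such that the inequality, with $\varepsilon W_2(\mu,\nu)$ in place of $o_R(W_2(\mu,\nu))$, holds for all such $\nu$ with $W_2(\mu,\nu)<\delta$. Likewise $\partial^-U(\mu)$ is the set of $\beta\in L^2(\mathbb R^m,\mu;\mathbb R^m)$ such that for every $R>0$ $$U(\nu)-U(\mu)\ge\inf_{\gamma\in\Gamma_2(\mu,\nu)}\int\langle\beta(x),y-x\rangle\,d\gamma(x,y)+o_R(W_2(\mu,\nu))$$ in the same sense. The measure $\mu$ is a regular point of $U$ if $\partial^+U(\mu)$ and $\partial^-U(\mu)$ are both nonempty, and a singular point of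 $U$ otherwise. Theorem. Let $\phi:\mathbb R^m\to\mathbb R$ be locally semiconcave, let $\phi(\nu):=\int_{\mathbb R^m}\phi\,d\nu$ for $\nu\in\mathscr P_c(\mathbb R^m)$ be its potential energy functional, and let $\mu\in\mathscr P_c(\mathbb R^m)$. Then $\mu$ is a singular point of $\phi(\cdot)$ if and only if $\mu(\operatorname{Sing}(\phi))>0$. Consequently, if $\mu$ is absolutely continuous with respect to Lebesgue measure on $\mathbb R^m$, then $\mu$ is a regular point of $\phi(\cdot)$. -/

import Mathlib

open MeasureTheory

noncomputable section

namespace WassersteinSing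

/-- The Euclidean space `ℝ^m`. -/
abbrev Euc (m : ℕ) : Type := EuclideanSpace ℝ (Fin m)

/-! ### Semiconcave functions -/

/-- `φ ∈ SCL(Ω)` with constant `C`: `φ` is continuous on `Ω` and at each `x ∈ Ω` there is a
covector `p` with `φ y ≤ φ x + ⟨p, y - x⟩ + (C / 2) |x - y|²` for all `y ∈ Ω`
(used for open convex sets `Ω`). -/
def IsSemiconcaveWith {m : ℕ} (C : ℝ) (Ω : Set (Euc m)) (φ : Euc m → ℝ) : Prop :=
  ContinuousOn φ Ω ∧
    ∀ x ∈ Ω, ∃ p : Euc m, ∀ y ∈ Ω, φ y ≤ φ x + inner ℝ p (y - x) + C / 2 * ‖x - y‖ ^ 2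

/-- `φ ∈ SCL_loc(ℝ^m)`: on each open ball `B(0, R)` the function `φ` is semiconcave with linear
modulus, for some constant `C ≥ 0` depending on `R`. -/
def IsLocallySemiconcave {m : ℕ} (φ : Euc m → ℝ) : Prop :=
  ∀ R : ℝ, 0 < R → ∃ C : ℝ, 0 ≤ C ∧ IsSemiconcaveWith C (Metric.ball 0 R) φ

/-- The (local) proximal superdifferential `D⁺φ(x)`. -/
def superdiff {m : ℕ} (φ : Euc m → ℝ) (x : Euc m) : Set (Euc m) :=
  {p | ∃ C : ℝ, 0 ≤ C ∧ ∃ r : ℝ, 0 < r ∧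
    ∀ y ∈ Metric.ball x r, φ y ≤ φ x + inner ℝ p (y - x) + C / 2 * ‖x - y‖ ^ 2}

/-- `Sing(φ)`: the points at which `D⁺φ(x)` is not a singleton. -/
def singSet {m : ℕ} (φ : Euc m → ℝ) : Set (Euc m) :=
  {x | ¬ ∃ p : Euc m, superdiff φ x = {p}}

/-! ### Transport plans and the quadratic Wasserstein distance -/

/-- `Γ(μ, ν)`: the transport plans between `μ` and `ν`. -/
def plans {m : ℕ} (μ ν : Measure (Euc m)) : Set (Measure (Euc m × Euc m)) :=
  {γ | γ.map Prod.fst = μ ∧ γ.map Prod.snd = ν}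

/-- The quadratic cost `∫ |x - y|² dγ` of a plan. -/
def planCost {m : ℕ} (γ : Measure (Euc m × Euc m)) : ENNReal :=
  ∫⁻ z, edist z.1 z.2 ^ 2 ∂γ

/-- `W₂(μ, ν)` (finite, hence without loss in `ℝ`, when `μ` and `ν` are probability measures with
compact support). -/
def W2 {m : ℕ} (μ ν : Measure (Euc m)) : ℝ :=
  Real.sqrt (⨅ γ ∈ plans μ ν, planCost γ).toReal

/-- `Γ₂(μ, ν)`: the optimal plans for `W₂(μ, ν)`. -/
def optPlans {m : ℕ} (μ ν : Measure (Euc m)) : Set (Measure (Euc m × Euc m)) :=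
  {γ | γ ∈ plans μ ν ∧ ∀ γ' ∈ plans μ ν, planCost γ ≤ planCost γ'}

/-! ### Functionals on compactly supported probability measures -/

/-- `𝒫_c(ℝ^m)`: the Borel probability measures on `ℝ^m` with compact support. -/
def Pc (m : ℕ) : Type :=
  {μ : Measure (Euc m) // IsProbabilityMeasure μ ∧ IsCompact μ.support}

/-- The measure underlying an element of `𝒫_c(ℝ^m)`. -/
def Pc.meas {m : ℕ} (μ : Pc m) : Measure (Euc m) := μ.1

/-- `B_R(μ)`: the union of the open balls of radius `R` centred at points of `supp μ`. -/
def fattening {m : ℕ} (R : ℝ) (μ : Pc m) : Set (Euc m) :=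
  ⋃ x ∈ μ.meas.support, Metric.ball x R

/-- The localized Fréchet superdifferential `∂⁺U(μ)`, a set of (classes of) vector fields in
`L²(ℝ^m; μ)`: for every `R > 0`,
`U(ν) - U(μ) ≤ sup_{γ ∈ Γ₂(μ, ν)} ∫ ⟨α(x), y - x⟩ dγ + o_R(W₂(μ, ν))` over `ν ∈ 𝒫(B_R(μ))`.
The supremum is taken in the extended reals. -/
def frechetSuper {m : ℕ} (U : Pc m → ℝ) (μ : Pc m) : Set (Lp (Euc m) 2 μ.meas) :=
  {α | ∀ R : ℝ, 0 < R → ∀ ε : ℝ, 0 < ε → ∃ δ : ℝ, 0 < δ ∧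
    ∀ ν : Pc m, ν.meas (fattening R μ)ᶜ = 0 → W2 μ.meas ν.meas < δ →
      ((U ν - U μ - ε * W2 μ.meas ν.meas : ℝ) : EReal) ≤
        ⨆ γ ∈ optPlans μ.meas ν.meas,
          ((∫ z, inner ℝ (α z.1) (z.2 - z.1) ∂γ : ℝ) : EReal)}

/-- The localized Fréchet subdifferential `∂⁻U(μ)`: for every `R > 0`,
`U(ν) - U(μ) ≥ inf_{γ ∈ Γ₂(μ, ν)} ∫ ⟨β(x), y - x⟩ dγ + o_R(W₂(μ, ν))` over `ν ∈ 𝒫(B_R(μ))`. -/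
def frechetSub {m : ℕ} (U : Pc m → ℝ) (μ : Pc m) : Set (Lp (Euc m) 2 μ.meas) :=
  {β | ∀ R : ℝ, 0 < R → ∀ ε : ℝ, 0 < ε → ∃ δ : ℝ, 0 < δ ∧
    ∀ ν : Pc m, ν.meas (fattening R μ)ᶜ = 0 → W2 μ.meas ν.meas < δ →
      (⨅ γ ∈ optPlans μ.meas ν.meas,
          ((∫ z, inner ℝ (β z.1) (z.2 - z.1) ∂γ : ℝ) : EReal)) ≤
        ((U ν - U μ + ε * W2 μ.meas ν.meas : ℝ) : EReal)}

/-- `μ` is a regular point of `U` (`U` is locally differentiable at `μ`): both `∂⁺U(μ)` and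
`∂⁻U(μ)` are nonempty. -/
def IsRegularPoint {m : ℕ} (U : Pc m → ℝ) (μ : Pc m) : Prop :=
  (frechetSuper U μ).Nonempty ∧ (frechetSub U μ).Nonempty

/-- `μ` is a singular point of `U`: `U` is not locally differentiable at `μ`. -/
def IsSingularPoint {m : ℕ} (U : Pc m → ℝ) (μ : Pc m) : Prop :=
  ¬ IsRegularPoint U μ

/-- The potential energy functional `φ(μ) = ∫ φ dμ` on `𝒫_c(ℝ^m)`. -/
def potential {m : ℕ} (φ : Euc m → ℝ) (μ : Pc m) : ℝ :=
  ∫ x, φ x ∂μ.meas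

end WassersteinSing

end

noncomputable section

namespace WassersteinSing

open Filter Topology
open scoped NNReal ENNReal

/-! ### Superdifferentials of semiconcave functions -/

variable {m : ℕ} {φ : Euc m → ℝ}

/-! A locally semiconcave `φ` is locally Lipschitz, `D⁺φ(x)` is never empty, and it is a singleton
exactly where `φ` is differentiable. So `Sing(φ)` is the set of non-differentiability
(`singSet_eq`), which is Lebesgue-null by Rademacher.

If `φ` is differentiable `μ`-a.e., the field `∇φ` lies in both `∂⁺` and `∂⁻`. By an Egorov-type
argument the first-order expansion of `φ` is uniform off a set of small `μ`-measure; Cauchy–Schwarz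
controls that set, and long displacements are paid for by the quadratic cost
(`abs_potential_sub_le`).

Conversely, let `β ∈ ∂⁻` and test it on the translates of `μ` by `hv` and `-hv`, whose only optimal
plans are the translations. Adding the two inequalities cancels `β` and bounds below, by `-o(1)`,
the integral of `(φ(x+hv) + φ(x-hv) - 2φ(x))/h`. Semiconcavity bounds this quotient above by
`C|v|²h`, so it tends to `0` in `L¹(μ)`, hence a.e. along a subsequence. But its upper limit is at
most `⟨p - q, v⟩` for all `p, q ∈ D⁺φ(x)`, so `⟨p, v⟩ = ⟨q, v⟩` (`ae_inner_eq_of_mem_frechetSub`).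
Taking `v` in a basis shows that `D⁺φ(x)` is a singleton `μ`-a.e. -/

theorem IsLocallySemiconcave.continuous (hφ : IsLocallySemiconcave φ) : Continuous φ := by
  refine continuous_iff_continuousAt.2 fun x => ?_
  obtain ⟨C, -, hc, -⟩ := hφ (‖x‖ + 1) (by positivity)
  exact hc.continuousAt (Metric.isOpen_ball.mem_nhds (by simp))

theorem IsLocallySemiconcave.exists_bounded_superdiff (hφ : IsLocallySemiconcave φ) {R : ℝ}
    (hR : 0 < R) : ∃ C M : ℝ, 0 ≤ C ∧ 0 ≤ M ∧ ∀ x ∈ Metric.ball (0 : Euc m) R, ∃ p : Euc m,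
      ‖p‖ ≤ M ∧ ∀ y ∈ Metric.ball (0 : Euc m) R,
        φ y ≤ φ x + inner ℝ p (y - x) + C / 2 * ‖x - y‖ ^ 2 := by
  obtain ⟨C, hC, -, h⟩ := hφ (R + 1) (by positivity)
  obtain ⟨B, hB⟩ := (isCompact_closedBall (0 : Euc m) (R + 1)).exists_bound_of_continuousOn
    hφ.continuous.continuousOn
  have hsub : Metric.ball (0 : Euc m) R ⊆ Metric.ball 0 (R + 1) :=
    Metric.ball_subset_ball (by linarith)
  refine ⟨C, 4 * |B| + C, hC, by positivity, fun x hx => ?_⟩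
  obtain ⟨p, hp⟩ := h x (hsub hx)
  refine ⟨p, ?_, fun y hy => hp y (hsub hy)⟩
  rcases eq_or_ne p 0 with rfl | hp0
  · simp; positivity
  have hpn : 0 < ‖p‖ := norm_pos_iff.2 hp0
  -- The test point `x - p/(2‖p‖)` stays in the larger ball, where `|φ| ≤ B`; there the inequality
  -- reads `‖p‖/2 ≤ 2B + C/8`.
  set t : ℝ := -(1 / 2) * ‖p‖⁻¹ with ht
  have hn : ‖t • p‖ = 1 / 2 := by
    rw [norm_smul, ht, Real.norm_eq_abs, abs_mul, abs_neg, abs_inv, abs_norm]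
    field_simp; norm_num
  have hx' : ‖x‖ < R := by simpa using hx
  have hy : x + t • p ∈ Metric.ball (0 : Euc m) (R + 1) := by
    have := norm_add_le x (t • p)
    simp only [mem_ball_zero_iff]; linarith
  have h1 := hp _ hy
  have h2 := hB x (by simp; linarith)
  have h3 := hB _ (Metric.ball_subset_closedBall hy)
  have hi : inner ℝ p (x + t • p - x) = -(1 / 2) * ‖p‖ := by
    rw [add_sub_cancel_left, inner_smul_right, real_inner_self_eq_norm_sq, ht]
    field_simp
  have hxx : x - (x + t • p) = -(t • p) := by abel
  rw [hi, hxx, norm_neg, hn] at h1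
  rw [Real.norm_eq_abs] at h2 h3
  have := le_abs_self B
  have := abs_le.1 h2
  have := abs_le.1 h3
  linarith

theorem IsLocallySemiconcave.exists_lipschitzOnWith (hφ : IsLocallySemiconcave φ) {R : ℝ}
    (hR : 0 < R) : ∃ L : ℝ≥0, LipschitzOnWith L φ (Metric.ball 0 R) := by
  obtain ⟨C, M, hC, hM, h⟩ := hφ.exists_bounded_superdiff hR
  -- In a ball of radius `R`, `C/2 * ‖x - y‖² ≤ C * R * ‖x - y‖`.
  refine ⟨(M + C * R).toNNReal, LipschitzOnWith.of_le_add_mul' _ fun y hy x hx => ?_⟩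
  obtain ⟨p, hpM, hp⟩ := h x hx
  have h1 := hp y hy
  have h2 := (real_inner_le_norm p (y - x)).trans
    (mul_le_mul_of_nonneg_right hpM (norm_nonneg _))
  have h3 : ‖x - y‖ ≤ 2 * R := by
    have := norm_sub_le x y
    simp only [mem_ball_zero_iff] at hx hy
    linarith
  rw [dist_eq_norm]
  rw [norm_sub_rev x y] at h1 h3
  nlinarith [norm_nonneg (y - x), mul_nonneg (mul_nonneg hC (norm_nonneg (y - x)))
    (sub_nonneg.2 h3)]

theorem IsLocallySemiconcave.superdiff_nonempty (hφ : IsLocallySemiconcave φ) (x : Euc m) :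
    (superdiff φ x).Nonempty := by
  obtain ⟨C, hC, -, h⟩ := hφ (‖x‖ + 1) (by positivity)
  obtain ⟨p, hp⟩ := h x (by simp)
  refine ⟨p, C, hC, 1, one_pos, fun y hy => hp y ?_⟩
  have := norm_add_le (y - x) x
  rw [Metric.mem_ball, dist_eq_norm] at hy
  rw [sub_add_cancel] at this
  rw [mem_ball_zero_iff]
  linarith

/-- Using `p` at `x + hv` and `q` at `x - hv` bounds the second difference quotient by `⟨p - q, v⟩ +
O(h)`. A single sequence `h k → 0` suffices, so a.e. convergence along a subsequence can be fed in.
-/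
theorem inner_le_of_mem_superdiff {x p q v : Euc m} {h : ℕ → ℝ} (hp : p ∈ superdiff φ x)
    (hq : q ∈ superdiff φ x) (hpos : ∀ k, 0 < h k) (hh : Tendsto h atTop (𝓝 0))
    (hlim : Tendsto (fun k => (φ (x + h k • v) + φ (x - h k • v) - 2 * φ x) / h k)
      atTop (𝓝 0)) :
    inner ℝ q v ≤ inner ℝ p v := by
  obtain ⟨C, -, r, hr, hp⟩ := hp
  obtain ⟨D, -, s, hs, hq⟩ := hq
  have hn : Tendsto (fun k => ‖h k • v‖) atTop (𝓝 0) := by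
    simpa using (hh.smul_const v).norm
  have hev : ∀ᶠ k in atTop, (φ (x + h k • v) + φ (x - h k • v) - 2 * φ x) / h k ≤
      inner ℝ p v - inner ℝ q v + (C + D) / 2 * ‖v‖ ^ 2 * h k := by
    filter_upwards [hn.eventually (gt_mem_nhds hr), hn.eventually (gt_mem_nhds hs)] with k h1 h2
    have a := hp (x + h k • v) (by simpa [dist_eq_norm] using h1)
    have b := hq (x - h k • v) (by simpa [dist_eq_norm] using h2)
    rw [div_le_iff₀ (hpos k)]
    have e1 : x + h k • v - x = h k • v := by abel
    have e2 : x - (x + h k • v) = -(h k • v) := by abel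
    have e3 : x - h k • v - x = -(h k • v) := by abel
    have e4 : x - (x - h k • v) = h k • v := by abel
    rw [e1, e2, norm_neg, inner_smul_right, norm_smul, mul_pow, Real.norm_eq_abs, sq_abs] at a
    rw [e3, e4, inner_neg_right, inner_smul_right, norm_smul, mul_pow, Real.norm_eq_abs,
      sq_abs] at b
    linarith
  have hr : Tendsto (fun k => inner ℝ p v - inner ℝ q v + (C + D) / 2 * ‖v‖ ^ 2 * h k) atTop
      (𝓝 (inner ℝ p v - inner ℝ q v)) := by
    simpa using (hh.const_mul ((C + D) / 2 * ‖v‖ ^ 2)).const_add (inner ℝ p v - inner ℝ q v)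
  linarith [le_of_tendsto_of_tendsto hlim hr hev]

/-- The paraboloid given by `p` touches `φ` from above at `x`, so right derivatives along each `v`
are ordered; replacing `v` by `-v` gives equality. -/
theorem eq_gradient_of_mem_superdiff {x p : Euc m} (hd : DifferentiableAt ℝ φ x)
    (hp : p ∈ superdiff φ x) : p = gradient φ x := by
  obtain ⟨C, -, r, hr, h⟩ := hp
  refine ext_inner_right ℝ fun v => ?_
  have key : ∀ v : Euc m, inner ℝ (gradient φ x) v ≤ inner ℝ p v := by
    intro v
    have hl : HasDerivAt (fun t : ℝ => φ (x + t • v)) (inner ℝ (gradient φ x) v) 0 := by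
      have := hd.hasGradientAt.hasFDerivAt.hasLineDerivAt v
      simpa [HasLineDerivAt] using this
    have hr' : HasDerivAt (fun t : ℝ => φ x + t * inner ℝ p v + C / 2 * ‖v‖ ^ 2 * t ^ 2)
        (inner ℝ p v) 0 := by
      have h1 := ((hasDerivAt_id (0 : ℝ)).mul_const (inner ℝ p v)).const_add (φ x)
      have h2 := ((hasDerivAt_id (0 : ℝ)).pow 2).const_mul (C / 2 * ‖v‖ ^ 2)
      convert! h1.add h2 using 1
      simp
    have hs := hl.tendsto_slope.mono_left (nhdsGT_le_nhdsNE 0)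
    have hs' := hr'.tendsto_slope.mono_left (nhdsGT_le_nhdsNE 0)
    refine le_of_tendsto_of_tendsto hs hs' ?_
    have hn : Tendsto (fun t : ℝ => ‖t • v‖) (𝓝[>] 0) (𝓝 0) := by
      have : Continuous fun t : ℝ => ‖t • v‖ := by fun_prop
      simpa using (this.tendsto 0).mono_left nhdsWithin_le_nhds
    filter_upwards [hn.eventually (gt_mem_nhds hr), self_mem_nhdsWithin] with t ht ht0
    have ht0 : 0 < t := ht0
    have a := h (x + t • v) (by simpa [dist_eq_norm] using ht)
    have e1 : x + t • v - x = t • v := by abel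
    have e2 : x - (x + t • v) = -(t • v) := by abel
    rw [e1, e2, norm_neg, inner_smul_right, norm_smul, mul_pow, Real.norm_eq_abs, sq_abs] at a
    simp only [slope, vsub_eq_sub, sub_zero, smul_eq_mul]
    refine mul_le_mul_of_nonneg_left ?_ (by positivity)
    simp
    linarith
  have h1 := key v
  have h2 := key (-v)
  simp only [inner_neg_right] at h2
  linarith

/-- A bounded selection `P y` of supergradients with a common constant `C` can only cluster, as `y →
x`, at elements of `D⁺φ(x)`, so it converges to `p`. The inequality based at `x` bounds `φ y - φ x`
above, the one based at `y` bounds it below, and the gap is `o(‖y - x‖)`. -/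
theorem IsLocallySemiconcave.differentiableAt_of_superdiff_eq (hφ : IsLocallySemiconcave φ)
    {x p : Euc m} (hx : superdiff φ x = {p}) : DifferentiableAt ℝ φ x := by
  have hR : 0 < ‖x‖ + 1 := by positivity
  obtain ⟨C, M, hC, hM, h⟩ := hφ.exists_bounded_superdiff hR
  choose! P hPM hP using h
  have hball : ∀ᶠ y in 𝓝 x, y ∈ Metric.ball (0 : Euc m) (‖x‖ + 1) :=
    Metric.isOpen_ball.mem_nhds (by simp)
  have hxb : x ∈ Metric.ball (0 : Euc m) (‖x‖ + 1) := hball.self_of_nhds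
  have hmem : ∀ q : Euc m, (∀ y ∈ Metric.ball (0 : Euc m) (‖x‖ + 1),
      φ y ≤ φ x + inner ℝ q (y - x) + C / 2 * ‖x - y‖ ^ 2) → q = p := by
    intro q hq
    obtain ⟨r, hr, hrs⟩ := Metric.eventually_nhds_iff_ball.1 hball
    have : q ∈ superdiff φ x := ⟨C, hC, r, hr, fun y hy => hq y (hrs y hy)⟩
    simpa [hx] using this
  have hPx : P x = p := hmem _ (hP x hxb)
  have hlim : Tendsto P (𝓝 x) (𝓝 p) := by
    refine (isCompact_closedBall (0 : Euc m) M).tendsto_nhds_of_unique_mapClusterPt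
      (hball.mono fun y hy => by simpa using hPM y hy) fun q _ hq => hmem q fun y hy => ?_
    obtain ⟨U, hU, hUq⟩ := mapClusterPt_iff_ultrafilter.1 hq
    have hid : Tendsto (fun z : Euc m => z) U (𝓝 x) := hU
    have h1 : Tendsto (fun z => φ z + inner ℝ (P z) (y - z) + C / 2 * ‖z - y‖ ^ 2) U
        (𝓝 (φ x + inner ℝ q (y - x) + C / 2 * ‖x - y‖ ^ 2)) :=
      (((hφ.continuous.tendsto x).comp hid).add (hUq.inner (tendsto_const_nhds.sub hid))).add
        (((hid.sub_const y).norm.pow 2).const_mul _)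
    exact ge_of_tendsto h1 ((hball.filter_mono hU).mono fun z hz => hP z hz y hy)
  have : HasGradientAt φ p x := by
    rw [hasGradientAt_iff_isLittleO]
    refine Asymptotics.isLittleO_iff.2 fun ε hε => ?_
    have h1 : ∀ᶠ y in 𝓝 x, ‖P y - p‖ + C / 2 * ‖x - y‖ < ε := by
      have : Tendsto (fun y => ‖P y - p‖ + C / 2 * ‖x - y‖) (𝓝 x)
          (𝓝 (‖p - p‖ + C / 2 * ‖x - x‖)) :=
        (hlim.sub_const p).norm.add ((tendsto_const_nhds.sub tendsto_id).norm.const_mul _)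
      exact this.eventually (gt_mem_nhds (by simpa using hε))
    filter_upwards [h1, hball] with y hy hyb
    have a := hP x hxb y hyb
    have b := hP y hyb x hxb
    rw [hPx] at a
    have c : |inner ℝ (P y - p) (y - x)| ≤ ‖P y - p‖ * ‖y - x‖ := abs_real_inner_le_norm _ _
    rw [inner_sub_left] at c
    have c := (abs_le.1 c)
    rw [← neg_sub y x, inner_neg_right] at b
    rw [norm_sub_rev x y] at a hy
    rw [Real.norm_eq_abs, abs_le]
    have hn := norm_nonneg (y - x)
    have hm := mul_le_mul_of_nonneg_right hy.le hn
    have := mul_nonneg (norm_nonneg (P y - p)) hn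
    constructor <;> nlinarith
  exact this.differentiableAt

theorem IsLocallySemiconcave.singSet_eq (hφ : IsLocallySemiconcave φ) :
    singSet φ = {x | ¬ DifferentiableAt ℝ φ x} := by
  ext x
  refine not_congr ⟨fun ⟨p, hp⟩ => hφ.differentiableAt_of_superdiff_eq hp, fun hd => ?_⟩
  exact ⟨gradient φ x, Set.eq_singleton_iff_nonempty_unique_mem.2
    ⟨hφ.superdiff_nonempty x, fun q hq => eq_gradient_of_mem_superdiff hd hq⟩⟩

theorem IsLocallySemiconcave.volume_singSet (hφ : IsLocallySemiconcave φ) :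
    (volume : Measure (Euc m)) (singSet φ) = 0 := by
  rw [hφ.singSet_eq]
  have : ∀ n : ℕ, ∀ᵐ x : Euc m, x ∈ Metric.ball (0 : Euc m) (n + 1) →
      DifferentiableAt ℝ φ x := by
    intro n
    obtain ⟨L, hL⟩ := hφ.exists_lipschitzOnWith (R := n + 1) (by positivity)
    filter_upwards [hL.ae_differentiableWithinAt_of_mem] with x hx hxb
    exact (hx hxb).differentiableAt (Metric.isOpen_ball.mem_nhds hxb)
  have h := ae_all_iff.2 this
  filter_upwards [h] with x hx
  obtain ⟨n, hn⟩ := exists_nat_gt ‖x‖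
  exact hx n (by simp; linarith)

/-! ### Optimal plans -/

instance Pc.isProbabilityMeasure (μ : Pc m) : IsProbabilityMeasure μ.meas := μ.2.1

theorem Pc.isCompact_support (μ : Pc m) : IsCompact μ.meas.support := μ.2.2

theorem isProbabilityMeasure_of_mem_plans {μ ν : Pc m} {γ : Measure (Euc m × Euc m)}
    (hγ : γ ∈ plans μ.meas ν.meas) : IsProbabilityMeasure γ := by
  have : IsProbabilityMeasure (γ.map Prod.fst) := by rw [hγ.1]; infer_instance
  exact Measure.isProbabilityMeasure_of_map Prod.fst

theorem ae_fst_of_mem_plans {μ ν : Measure (Euc m)} {γ : Measure (Euc m × Euc m)}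
    (hγ : γ ∈ plans μ ν) {P : Euc m → Prop} (h : ∀ᵐ x ∂μ, P x) : ∀ᵐ z ∂γ, P z.1 := by
  rw [← hγ.1] at h
  exact ae_of_ae_map measurable_fst.aemeasurable h

theorem ae_snd_of_mem_plans {μ ν : Measure (Euc m)} {γ : Measure (Euc m × Euc m)}
    (hγ : γ ∈ plans μ ν) {P : Euc m → Prop} (h : ∀ᵐ x ∂ν, P x) : ∀ᵐ z ∂γ, P z.2 := by
  rw [← hγ.2] at h
  exact ae_of_ae_map measurable_snd.aemeasurable h

theorem ae_mem_support_prod {μ ν : Pc m} {γ : Measure (Euc m × Euc m)}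
    (hγ : γ ∈ plans μ.meas ν.meas) :
    ∀ᵐ z ∂γ, z ∈ μ.meas.support ×ˢ ν.meas.support := by
  filter_upwards [ae_fst_of_mem_plans hγ Measure.support_mem_ae,
    ae_snd_of_mem_plans hγ Measure.support_mem_ae] with z h1 h2
  exact ⟨h1, h2⟩

theorem integrable_of_continuous_of_isCompact {X F : Type*} [TopologicalSpace X]
    [MeasurableSpace X] [BorelSpace X] [SecondCountableTopology X]
    [TopologicalSpace.PseudoMetrizableSpace X]
    [NormedAddCommGroup F] {γ : Measure X} [IsFiniteMeasure γ] {K : Set X} (hK : IsCompact K)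
    (hγ : ∀ᵐ z ∂γ, z ∈ K) {f : X → F} (hf : Continuous f) : Integrable f γ := by
  obtain ⟨B, hB⟩ := hK.exists_bound_of_continuousOn hf.continuousOn
  exact Integrable.of_bound hf.aestronglyMeasurable B (hγ.mono hB)

theorem Pc.integrable (μ : Pc m) {F : Type*} [NormedAddCommGroup F] {f : Euc m → F}
    (hf : Continuous f) : Integrable f μ.meas :=
  integrable_of_continuous_of_isCompact μ.isCompact_support Measure.support_mem_ae hf

theorem integrable_of_mem_plans {μ ν : Pc m} {γ : Measure (Euc m × Euc m)}
    (hγ : γ ∈ plans μ.meas ν.meas) {F : Type*} [NormedAddCommGroup F] {f : Euc m × Euc m → F}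
    (hf : Continuous f) : Integrable f γ :=
  have := isProbabilityMeasure_of_mem_plans hγ
  integrable_of_continuous_of_isCompact (μ.isCompact_support.prod ν.isCompact_support)
    (ae_mem_support_prod hγ) hf

theorem planCost_eq {μ ν : Pc m} {γ : Measure (Euc m × Euc m)}
    (hγ : γ ∈ plans μ.meas ν.meas) :
    planCost γ = ENNReal.ofReal (∫ z, ‖z.2 - z.1‖ ^ 2 ∂γ) := by
  rw [ofReal_integral_eq_lintegral_ofReal (integrable_of_mem_plans hγ (by fun_prop))
    (ae_of_all _ fun _ => by positivity), planCost]
  refine lintegral_congr fun z => ?_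
  rw [edist_comm, edist_dist, dist_eq_norm, ENNReal.ofReal_pow (norm_nonneg _)]

theorem W2_eq_of_mem_optPlans {μ ν : Pc m} {γ : Measure (Euc m × Euc m)}
    (hγ : γ ∈ optPlans μ.meas ν.meas) :
    W2 μ.meas ν.meas = √(∫ z, ‖z.2 - z.1‖ ^ 2 ∂γ) := by
  have : (⨅ γ ∈ plans μ.meas ν.meas, planCost γ) = planCost γ :=
    le_antisymm (iInf₂_le γ hγ.1) (le_iInf₂ hγ.2)
  rw [W2, this, planCost_eq hγ.1, ENNReal.toReal_ofReal (integral_nonneg fun _ => by positivity)]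

theorem integral_fst_of_mem_plans {μ ν : Measure (Euc m)} {γ : Measure (Euc m × Euc m)}
    (hγ : γ ∈ plans μ ν) {F : Type*} [NormedAddCommGroup F] [NormedSpace ℝ F] {f : Euc m → F}
    (hf : AEStronglyMeasurable f μ) : ∫ z, f z.1 ∂γ = ∫ x, f x ∂μ := by
  have h := hγ.1
  subst h
  exact (integral_map measurable_fst.aemeasurable hf).symm

theorem integral_snd_of_mem_plans {μ ν : Measure (Euc m)} {γ : Measure (Euc m × Euc m)}
    (hγ : γ ∈ plans μ ν) {F : Type*} [NormedAddCommGroup F] [NormedSpace ℝ F] {f : Euc m → F}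
    (hf : AEStronglyMeasurable f ν) : ∫ z, f z.2 ∂γ = ∫ x, f x ∂ν := by
  have h := hγ.2
  subst h
  exact (integral_map measurable_snd.aemeasurable hf).symm

theorem prod_mem_plans (μ ν : Pc m) : μ.meas.prod ν.meas ∈ plans μ.meas ν.meas := by
  constructor
  · simp [Measure.map_fst_prod]
  · simp [Measure.map_snd_prod]

/-- Optimal plans exist between compactly supported probability measures. -/
theorem optPlans_nonempty (μ ν : Pc m) : (optPlans μ.meas ν.meas).Nonempty := by
  set S : Set (ProbabilityMeasure (Euc m × Euc m)) :=
    {γ | (γ : Measure (Euc m × Euc m)) ∈ plans μ.meas ν.meas} with hS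
  have hKc : IsCompact (μ.meas.support ×ˢ ν.meas.support) :=
    μ.isCompact_support.prod ν.isCompact_support
  have hclosed : IsClosed S := by
    have h1 := ProbabilityMeasure.continuous_map (Ω := Euc m × Euc m) (Ω' := Euc m) continuous_fst
    have h2 := ProbabilityMeasure.continuous_map (Ω := Euc m × Euc m) (Ω' := Euc m) continuous_snd
    have : S = (fun γ : ProbabilityMeasure (Euc m × Euc m) =>
          γ.map continuous_fst.measurable.aemeasurable) ⁻¹' {⟨μ.meas, inferInstance⟩} ∩
        (fun γ : ProbabilityMeasure (Euc m × Euc m) =>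
          γ.map continuous_snd.measurable.aemeasurable) ⁻¹' {⟨ν.meas, inferInstance⟩} := by
      ext γ
      constructor
      · rintro ⟨a, b⟩
        exact ⟨Subtype.ext a, Subtype.ext b⟩
      · rintro ⟨a, b⟩
        exact ⟨congrArg Subtype.val a, congrArg Subtype.val b⟩
    rw [this]
    exact (isClosed_singleton.preimage h1).inter (isClosed_singleton.preimage h2)
  -- All plans are carried by one compact set, hence are tight: Prokhorov's theorem applies.
  have hcomp : IsCompact S := by
    rw [← hclosed.closure_eq]
    refine isCompact_closure_of_isTightMeasureSet
      (isTightMeasureSet_iff_exists_isCompact_measure_compl_le.2 fun ε _ => ⟨_, hKc, ?_⟩)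
    rintro _ ⟨γ, hγ, rfl⟩
    exact (ae_iff.1 (ae_mem_support_prod hγ)).le.trans zero_le
  obtain ⟨B, hB⟩ := hKc.exists_bound_of_continuousOn
    (f := fun z : Euc m × Euc m => dist z.1 z.2 ^ 2) (by fun_prop)
  -- Truncating the cost at its bound on the product of the supports changes no plan's cost and
  -- makes it weakly continuous.
  let f : BoundedContinuousFunction (Euc m × Euc m) ℝ≥0 :=
    BoundedContinuousFunction.mkOfBound
      ⟨fun z => min (nndist z.1 z.2 ^ 2) B.toNNReal, by fun_prop⟩ B.toNNReal fun z w => by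
        simp only [ContinuousMap.coe_mk, NNReal.dist_eq]
        rw [abs_le]
        have h1 := min_le_right (nndist z.1 z.2 ^ 2) B.toNNReal
        have h2 := min_le_right (nndist w.1 w.2 ^ 2) B.toNNReal
        have h1 := NNReal.coe_le_coe.2 h1
        have h2 := NNReal.coe_le_coe.2 h2
        have h3 := NNReal.coe_nonneg (min (nndist z.1 z.2 ^ 2) B.toNNReal)
        have h4 := NNReal.coe_nonneg (min (nndist w.1 w.2 ^ 2) B.toNNReal)
        constructor <;> linarith
  have hcost : ∀ γ ∈ plans μ.meas ν.meas, planCost γ = ∫⁻ z, f z ∂γ := by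
    intro γ hγ
    refine lintegral_congr_ae ?_
    filter_upwards [ae_mem_support_prod hγ] with z hz
    have h1 : nndist z.1 z.2 ^ 2 ≤ B.toNNReal := by
      have := hB z hz
      exact NNReal.le_toNNReal_of_coe_le (by simpa using this)
    change _ = ((min (nndist z.1 z.2 ^ 2) B.toNNReal : ℝ≥0) : ℝ≥0∞)
    rw [min_eq_left h1, edist_nndist, ENNReal.coe_pow]
  have hne : S.Nonempty := by
    have := isProbabilityMeasure_of_mem_plans (prod_mem_plans μ ν)
    exact ⟨⟨_, this⟩, prod_mem_plans μ ν⟩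
  obtain ⟨γ, hγ, hmin⟩ := hcomp.exists_isMinOn hne
    (ProbabilityMeasure.continuous_lintegral_boundedContinuousFunction f).continuousOn
  refine ⟨γ, hγ, fun γ' hγ' => ?_⟩
  rw [hcost _ hγ, hcost _ hγ']
  exact hmin (a := (⟨γ', isProbabilityMeasure_of_mem_plans hγ'⟩ : ProbabilityMeasure _)) hγ'

/-- The translate of a compactly supported probability measure. -/
def Pc.translate (μ : Pc m) (v : Euc m) : Pc m :=
  ⟨μ.meas.map (· + v), Measure.isProbabilityMeasure_map (by fun_prop), by
    have hc : IsCompact ((· + v) '' μ.meas.support) :=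
      μ.isCompact_support.image (by fun_prop)
    refine hc.of_isClosed_subset Measure.isClosed_support
      (Measure.support_subset_of_isClosed hc.isClosed ?_)
    rw [mem_ae_map_iff (by fun_prop) hc.isClosed.measurableSet]
    filter_upwards [Measure.support_mem_ae (μ := μ.meas)] with x hx
    exact ⟨x, hx, rfl⟩⟩

theorem Pc.meas_translate (μ : Pc m) (v : Euc m) :
    (μ.translate v).meas = μ.meas.map (· + v) := rfl

theorem integral_translate (μ : Pc m) (v : Euc m) {F : Type*} [NormedAddCommGroup F]
    [NormedSpace ℝ F] {f : Euc m → F} (hf : Continuous f) :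
    ∫ y, f y ∂(μ.translate v).meas = ∫ x, f (x + v) ∂μ.meas := by
  rw [Pc.meas_translate, integral_map (by fun_prop)
    hf.aestronglyMeasurable]

theorem translate_fattening_compl (μ : Pc m) {v : Euc m} {R : ℝ} (hv : ‖v‖ < R) :
    (μ.translate v).meas (fattening R μ)ᶜ = 0 := by
  have hm : MeasurableSet (fattening R μ) :=
    (isOpen_biUnion fun _ _ => Metric.isOpen_ball).measurableSet
  rw [Pc.meas_translate, Measure.map_apply (by fun_prop) hm.compl]
  refine measure_mono_null ?_ (Measure.measure_compl_support (μ := μ.meas))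
  intro x hx hxs
  exact hx (Set.mem_biUnion hxs (by simpa [dist_eq_norm] using hv))

/-- Every plan to the translate has mean displacement `v`, so this is the variance identity for `z.2
- z.1`. -/
theorem integral_sq_dist_translate {μ : Pc m} {v : Euc m} {γ : Measure (Euc m × Euc m)}
    (hγ : γ ∈ plans μ.meas (μ.translate v).meas) :
    ∫ z, ‖z.2 - z.1 - v‖ ^ 2 ∂γ = (∫ z, ‖z.2 - z.1‖ ^ 2 ∂γ) - ‖v‖ ^ 2 := by
  have := isProbabilityMeasure_of_mem_plans hγ
  have h1 : Integrable (fun z : Euc m × Euc m => ‖z.2 - z.1‖ ^ 2) γ :=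
    integrable_of_mem_plans hγ (by fun_prop)
  have h2 : Integrable (fun z : Euc m × Euc m => z.2) γ :=
    integrable_of_mem_plans hγ (by fun_prop)
  have h3 : Integrable (fun z : Euc m × Euc m => z.1) γ :=
    integrable_of_mem_plans hγ (by fun_prop)
  have hmean : ∫ z, (z.2 - z.1) ∂γ = v := by
    rw [integral_sub h2 h3,
      integral_snd_of_mem_plans hγ (f := fun y => y) aestronglyMeasurable_id,
      integral_fst_of_mem_plans hγ (f := fun y => y) aestronglyMeasurable_id,
      integral_translate μ v (f := fun y => y) continuous_id,
      integral_add (μ.integrable (f := fun y => y) continuous_id) (integrable_const v)]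
    simp
  have h4 : Integrable (fun z : Euc m × Euc m => 2 * inner ℝ v (z.2 - z.1)) γ :=
    integrable_of_mem_plans hγ (by fun_prop)
  have hi : ∫ z, 2 * inner ℝ v (z.2 - z.1) ∂γ = 2 * ‖v‖ ^ 2 := by
    rw [integral_const_mul, integral_inner (f := fun z : Euc m × Euc m => z.2 - z.1) (h2.sub h3), hmean, real_inner_self_eq_norm_sq]
  have hexp : ∀ z : Euc m × Euc m, ‖z.2 - z.1 - v‖ ^ 2 =
      ‖z.2 - z.1‖ ^ 2 - 2 * inner ℝ v (z.2 - z.1) + ‖v‖ ^ 2 := fun z => by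
    rw [norm_sub_sq_real, real_inner_comm]
  simp_rw [hexp]
  rw [integral_add (f := fun z : Euc m × Euc m => ‖z.2 - z.1‖ ^ 2 - 2 * inner ℝ v (z.2 - z.1))
    (h1.sub h4) (integrable_const _), integral_sub h1 h4, hi]
  simp
  ring

theorem translation_mem_plans (μ : Pc m) (v : Euc m) :
    μ.meas.map (fun x => (x, x + v)) ∈ plans μ.meas (μ.translate v).meas := by
  constructor
  · rw [Measure.map_map (by fun_prop) (by fun_prop)]
    exact Measure.map_id
  · rw [Measure.map_map (by fun_prop) (by fun_prop), Pc.meas_translate]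
    rfl

/-- The only optimal plan between a measure and its translate is the translation. -/
theorem optPlans_translate {μ : Pc m} {v : Euc m} {γ : Measure (Euc m × Euc m)}
    (hγ : γ ∈ optPlans μ.meas (μ.translate v).meas) :
    W2 μ.meas (μ.translate v).meas = ‖v‖ ∧ ∀ᵐ z ∂γ, z.2 - z.1 = v := by
  have hle := hγ.2 _ (translation_mem_plans μ v)
  rw [planCost_eq hγ.1, planCost_eq (translation_mem_plans μ v),
    ENNReal.ofReal_le_ofReal_iff (integral_nonneg fun _ => by positivity),
    integral_map (by fun_prop) (by fun_prop)] at hle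
  simp only [add_sub_cancel_left, integral_const, probReal_univ, one_smul] at hle
  -- Comparison with the translation gave second moment at most `‖v‖²`; the variance is therefore
  -- zero.
  have heq := integral_sq_dist_translate hγ.1
  have hnn : 0 ≤ ∫ z, ‖z.2 - z.1 - v‖ ^ 2 ∂γ := integral_nonneg fun _ => by positivity
  constructor
  · rw [W2_eq_of_mem_optPlans hγ, show ∫ z, ‖z.2 - z.1‖ ^ 2 ∂γ = ‖v‖ ^ 2 by linarith,
      Real.sqrt_sq (norm_nonneg _)]
  · have h0 : ∫ z, ‖z.2 - z.1 - v‖ ^ 2 ∂γ = 0 := by linarith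
    rw [integral_eq_zero_iff_of_nonneg (fun _ => by positivity)
      (integrable_of_mem_plans hγ.1 (by fun_prop))] at h0
    filter_upwards [h0] with z hz
    simpa [sub_eq_zero] using hz

theorem exists_ball_contains (μ : Pc m) (R : ℝ) :
    ∃ R' : ℝ, 0 < R' ∧ μ.meas.support ⊆ Metric.ball 0 R' ∧ fattening R μ ⊆ Metric.ball 0 R' := by
  obtain ⟨r, hr⟩ := μ.isCompact_support.isBounded.subset_ball (0 : Euc m)
  refine ⟨max r 1 + |R|, by positivity, hr.trans (Metric.ball_subset_ball ?_),
    Set.iUnion₂_subset fun x hx y hy => ?_⟩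
  · linarith [le_max_left r 1, abs_nonneg R]
  · have h1 := hr hx
    rw [mem_ball_zero_iff] at *
    rw [Metric.mem_ball, dist_eq_norm] at hy
    have := norm_add_le (y - x) x
    rw [sub_add_cancel] at this
    linarith [le_max_left r 1, le_abs_self R]

/-! ### Differentiability at almost every point gives a regular point -/

theorem measurable_gradient (φ : Euc m → ℝ) : Measurable (gradient φ) :=
  (InnerProductSpace.toDual ℝ (Euc m)).symm.continuous.measurable.comp (measurable_fderiv ℝ φ)

theorem norm_gradient_le {R : ℝ} {L : ℝ≥0} (hL : LipschitzOnWith L φ (Metric.ball 0 R))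
    {x : Euc m} (hx : x ∈ Metric.ball 0 R) : ‖gradient φ x‖ ≤ L := by
  rw [gradient, LinearIsometryEquiv.norm_map]
  exact norm_fderiv_le_of_lipschitzOn ℝ (Metric.isOpen_ball.mem_nhds hx) hL

theorem memLp_gradient (hφ : IsLocallySemiconcave φ) (μ : Pc m) :
    MemLp (gradient φ) 2 μ.meas := by
  obtain ⟨R, hR, hμ, -⟩ := exists_ball_contains μ 0
  obtain ⟨L, hL⟩ := hφ.exists_lipschitzOnWith hR
  refine MemLp.of_bound (measurable_gradient φ).aestronglyMeasurable L ?_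
  filter_upwards [Measure.support_mem_ae (μ := μ.meas)] with x hx
  exact norm_gradient_le hL (hμ hx)

/-- The points at which the first-order expansion of `φ` has error at most `ε ‖v‖` for all
`‖v‖ < r`. -/
def expansionSet (φ : Euc m → ℝ) (ε r : ℝ) : Set (Euc m) :=
  {x | ∀ v : Euc m, ‖v‖ < r → |φ (x + v) - φ x - inner ℝ (gradient φ x) v| ≤ ε * ‖v‖}

/-- For fixed `x` the condition is closed in `v`, so a countable dense set of `v` suffices. -/
theorem measurableSet_expansionSet (hφ : Continuous φ) (ε r : ℝ) :
    MeasurableSet (expansionSet φ ε r) := by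
  obtain ⟨D, hDc, hD⟩ := TopologicalSpace.exists_countable_dense (Euc m)
  have : expansionSet φ ε r = ⋂ v ∈ D ∩ Metric.ball 0 r,
      {x | |φ (x + v) - φ x - inner ℝ (gradient φ x) v| ≤ ε * ‖v‖} := by
    ext x
    simp only [Set.mem_iInter]
    refine ⟨fun h v hv => h v (by simpa using hv.2), fun h v hv => ?_⟩
    have hcl : IsClosed {v : Euc m | |φ (x + v) - φ x - inner ℝ (gradient φ x) v| ≤ ε * ‖v‖} :=
      isClosed_le (by fun_prop) (by fun_prop)
    have hsub : D ∩ Metric.ball 0 r ⊆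
        {v : Euc m | |φ (x + v) - φ x - inner ℝ (gradient φ x) v| ≤ ε * ‖v‖} := h
    have hv' : v ∈ closure (D ∩ Metric.ball 0 r) := by
      rw [Set.inter_comm]
      exact hD.open_subset_closure_inter Metric.isOpen_ball (by simpa using hv)
    exact hcl.closure_subset_iff.2 hsub hv'
  rw [this]
  refine MeasurableSet.biInter (hDc.mono Set.inter_subset_left) fun v _ => ?_
  have := measurable_gradient φ
  refine measurableSet_le ?_ measurable_const
  exact (((hφ.measurable.comp (measurable_add_const v)).sub hφ.measurable).sub
    (this.inner measurable_const)).abs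

/-- The sets increase with `n` and exhaust the differentiability points; this replaces Egorov's
theorem. -/
theorem tendsto_measure_expansionSet_compl (hφ : Continuous φ) {μ : Pc m}
    (hμ : ∀ᵐ x ∂μ.meas, DifferentiableAt ℝ φ x) {ε : ℝ} (hε : 0 < ε) :
    Tendsto (fun n : ℕ => μ.meas.real (expansionSet φ ε (1 / (n + 1)))ᶜ) atTop (𝓝 0) := by
  have h := tendsto_measure_iInter_atTop (μ := μ.meas)
    (s := fun n : ℕ => (expansionSet φ ε (1 / (n + 1)))ᶜ)
    (fun n => (measurableSet_expansionSet hφ _ _).compl.nullMeasurableSet)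
    (fun k n hkn => Set.compl_subset_compl.2 fun x hx v hv =>
      hx v (hv.trans_le (one_div_le_one_div_of_le (by positivity) (by gcongr))))
    ⟨0, measure_ne_top _ _⟩
  have h0 : μ.meas (⋂ n : ℕ, (expansionSet φ ε (1 / (n + 1)))ᶜ) = 0 := by
    rw [← Set.compl_iUnion]
    change ∀ᵐ x ∂μ.meas, x ∈ ⋃ n : ℕ, expansionSet φ ε (1 / (n + 1))
    filter_upwards [hμ] with x hx
    have hlo := hasGradientAt_iff_isLittleO_nhds_zero.1 hx.hasGradientAt
    obtain ⟨r, hr, hb⟩ := Metric.eventually_nhds_iff_ball.1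
      (Asymptotics.isLittleO_iff.1 hlo hε)
    obtain ⟨n, hn⟩ := exists_nat_one_div_lt hr
    refine Set.mem_iUnion.2 ⟨n, fun v hv => ?_⟩
    simpa using hb v (by simpa using hv.trans hn)
  rw [h0] at h
  have := (ENNReal.tendsto_toReal ENNReal.zero_ne_top).comp h
  simpa [Measure.real, Function.comp_def] using this

theorem integral_indicator_mul_le {X : Type*} [MeasurableSpace X] {γ : Measure X}
    [IsProbabilityMeasure γ] {S : Set X} (hS : MeasurableSet S) {d : X → ℝ} (hd : MemLp d 2 γ)
    (hd0 : ∀ z, 0 ≤ d z) :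
    ∫ z, S.indicator 1 z * d z ∂γ ≤ √(γ.real S) * √(∫ z, d z ^ 2 ∂γ) := by
  have h1 : MemLp (S.indicator (1 : X → ℝ)) 2 γ :=
    (memLp_const (1 : ℝ)).indicator hS
  have h := integral_mul_le_Lp_mul_Lq_of_nonneg (μ := γ) Real.HolderConjugate.two_two
    (f := S.indicator 1) (g := d)
    (ae_of_all _ fun z => Set.indicator_nonneg (fun _ _ => zero_le_one) z)
    (ae_of_all _ hd0) (by simpa using h1) (by simpa using hd)
  simp only [Real.rpow_two] at h
  have h2 : ∀ z, S.indicator (1 : X → ℝ) z ^ 2 = S.indicator 1 z := fun z => by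
    by_cases hz : z ∈ S <;> simp [hz]
  simp only [h2] at h
  rw [integral_indicator_one hS] at h
  simpa only [Real.sqrt_eq_rpow] using h

/-- First-order expansion of the potential energy along optimal plans. -/
theorem abs_potential_sub_le (hφ : IsLocallySemiconcave φ) {μ : Pc m}
    (hμ : ∀ᵐ x ∂μ.meas, DifferentiableAt ℝ φ x) (R : ℝ) {ε : ℝ} (hε : 0 < ε) :
    ∃ δ : ℝ, 0 < δ ∧ ∀ ν : Pc m, ν.meas (fattening R μ)ᶜ = 0 → W2 μ.meas ν.meas < δ →
      ∀ γ ∈ optPlans μ.meas ν.meas,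
        |potential φ ν - potential φ μ - ∫ z, inner ℝ (gradient φ z.1) (z.2 - z.1) ∂γ| ≤
          ε * W2 μ.meas ν.meas := by
  obtain ⟨R', hR', hsupp, hfat⟩ := exists_ball_contains μ R
  obtain ⟨L, hL⟩ := hφ.exists_lipschitzOnWith hR'
  have hε3 : 0 < ε / 3 := by positivity
  have hc := hφ.continuous
  obtain ⟨n, hn⟩ : ∃ n : ℕ, 2 * L *
      √(μ.meas.real (expansionSet φ (ε / 3) (1 / (n + 1)))ᶜ) < ε / 3 := by
    have h := ((tendsto_measure_expansionSet_compl hc hμ hε3).sqrt).const_mul (2 * (L : ℝ))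
    rw [Real.sqrt_zero, mul_zero] at h
    exact (h.eventually (gt_mem_nhds hε3)).exists
  set A := expansionSet φ (ε / 3) (1 / (n + 1)) with hA
  have hAm : MeasurableSet A := measurableSet_expansionSet hc _ _
  have hK : 0 < 2 * (L : ℝ) * (n + 1) + 1 := by positivity
  -- Chosen so that `2L(n+1) * W₂² ≤ (ε/3) * W₂`; the `+ 1` covers `L = 0`.
  refine ⟨ε / 3 / (2 * L * (n + 1) + 1), by positivity, fun ν hν hW γ hγ => ?_⟩
  have := isProbabilityMeasure_of_mem_plans hγ.1
  rw [lt_div_iff₀ hK] at hW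
  rw [W2_eq_of_mem_optPlans hγ] at hW ⊢
  set I := ∫ z, ‖z.2 - z.1‖ ^ 2 ∂γ with hI
  have hI0 : 0 ≤ I := integral_nonneg fun _ => by positivity
  have hmem : ∀ᵐ z ∂γ, z.1 ∈ Metric.ball (0 : Euc m) R' ∧ z.2 ∈ Metric.ball (0 : Euc m) R' := by
    have h2 : ∀ᵐ y ∂ν.meas, y ∈ fattening R μ := hν
    filter_upwards [ae_fst_of_mem_plans hγ.1 Measure.support_mem_ae,
      ae_snd_of_mem_plans hγ.1 h2] with z h1 h2
    exact ⟨hsupp h1, hfat h2⟩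
  have hi1 : Integrable (fun z : Euc m × Euc m => φ z.2) γ :=
    integrable_of_mem_plans hγ.1 (by fun_prop)
  have hi2 : Integrable (fun z : Euc m × Euc m => φ z.1) γ :=
    integrable_of_mem_plans hγ.1 (by fun_prop)
  have hgm := measurable_gradient φ
  have hi3 : Integrable (fun z : Euc m × Euc m => inner ℝ (gradient φ z.1) (z.2 - z.1)) γ := by
    refine ((integrable_of_mem_plans hγ.1
      (f := fun z : Euc m × Euc m => (L : ℝ) * ‖z.2 - z.1‖) (by fun_prop))).mono'
      ((hgm.comp measurable_fst).inner
        (measurable_snd.sub measurable_fst)).aestronglyMeasurable ?_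
    filter_upwards [hmem] with z hz
    exact (norm_inner_le_norm _ _).trans
      (mul_le_mul_of_nonneg_right (norm_gradient_le hL hz.1) (norm_nonneg _))
  have heq : potential φ ν - potential φ μ - ∫ z, inner ℝ (gradient φ z.1) (z.2 - z.1) ∂γ =
      ∫ z, (φ z.2 - φ z.1 - inner ℝ (gradient φ z.1) (z.2 - z.1)) ∂γ := by
    rw [integral_sub (f := fun z : Euc m × Euc m => φ z.2 - φ z.1) (hi1.sub hi2) hi3,
      integral_sub hi1 hi2, integral_snd_of_mem_plans hγ.1 hc.aestronglyMeasurable,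
      integral_fst_of_mem_plans hγ.1 hc.aestronglyMeasurable]
    rfl
  set S : Set (Euc m × Euc m) := Prod.fst ⁻¹' Aᶜ with hS
  have hSm : MeasurableSet S := measurable_fst hAm.compl
  have hSμ : γ.real S = μ.meas.real Aᶜ := by
    rw [← hγ.1.1, map_measureReal_apply measurable_fst hAm.compl]
  have hd : Integrable (fun z : Euc m × Euc m => ‖z.2 - z.1‖) γ :=
    integrable_of_mem_plans hγ.1 (by fun_prop)
  have hd2 : Integrable (fun z : Euc m × Euc m => ‖z.2 - z.1‖ ^ 2) γ :=
    integrable_of_mem_plans hγ.1 (by fun_prop)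
  have hdL : MemLp (fun z : Euc m × Euc m => ‖z.2 - z.1‖) 2 γ :=
    (memLp_two_iff_integrable_sq (by fun_prop)).2 hd2
  have hiS : Integrable (fun z => S.indicator (1 : Euc m × Euc m → ℝ) z * ‖z.2 - z.1‖) γ := by
    have : (fun z => S.indicator (1 : Euc m × Euc m → ℝ) z * ‖z.2 - z.1‖) =
        S.indicator fun z => ‖z.2 - z.1‖ := by
      ext z
      by_cases hz : z ∈ S <;> simp [hz]
    rw [this]
    exact hd.indicator hSm
  -- The three terms correspond to: `z.1 ∈ A` with a short displacement; `z.1 ∉ A`; and a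
  -- displacement `d ≥ 1/(n+1)`, where `d ≤ (n+1)d²`. The last two use the Lipschitz bound `2L * d`.
  have hpt : ∀ᵐ z ∂γ, ‖φ z.2 - φ z.1 - inner ℝ (gradient φ z.1) (z.2 - z.1)‖ ≤
      ε / 3 * ‖z.2 - z.1‖ + 2 * L * (S.indicator (1 : Euc m × Euc m → ℝ) z * ‖z.2 - z.1‖) +
        2 * L * (n + 1) * ‖z.2 - z.1‖ ^ 2 := by
    filter_upwards [hmem] with z hz
    have hgr : ‖φ z.2 - φ z.1 - inner ℝ (gradient φ z.1) (z.2 - z.1)‖ ≤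
        2 * L * ‖z.2 - z.1‖ := by
      have h1 : ‖φ z.2 - φ z.1‖ ≤ L * ‖z.2 - z.1‖ := by
        simpa [dist_eq_norm] using hL.dist_le_mul z.2 hz.2 z.1 hz.1
      have h2 : ‖inner ℝ (gradient φ z.1) (z.2 - z.1)‖ ≤ L * ‖z.2 - z.1‖ :=
        (norm_inner_le_norm _ _).trans
          (mul_le_mul_of_nonneg_right (norm_gradient_le hL hz.1) (norm_nonneg _))
      linarith [norm_sub_le (φ z.2 - φ z.1) (inner ℝ (gradient φ z.1) (z.2 - z.1))]
    have hn0 := norm_nonneg (z.2 - z.1)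
    have hL0 := L.2
    have ht1 : 0 ≤ ε / 3 * ‖z.2 - z.1‖ := by positivity
    have ht2 : 0 ≤ 2 * L * (S.indicator (1 : Euc m × Euc m → ℝ) z * ‖z.2 - z.1‖) :=
      mul_nonneg (by positivity)
        (mul_nonneg (Set.indicator_nonneg (fun _ _ => zero_le_one) z) hn0)
    have ht3 : 0 ≤ 2 * L * (n + 1) * ‖z.2 - z.1‖ ^ 2 := by positivity
    by_cases hzS : z ∈ S
    · rw [Set.indicator_of_mem hzS, Pi.one_apply, one_mul] at *
      linarith
    rcases lt_or_ge ‖z.2 - z.1‖ (1 / (n + 1)) with hlt | hge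
    · have hzA : z.1 ∈ A := by simpa [hS] using hzS
      have := hzA _ hlt
      rw [add_sub_cancel] at this
      rw [Real.norm_eq_abs]
      linarith
    · have h1 : 1 ≤ (n + 1) * ‖z.2 - z.1‖ := by
        rwa [div_le_iff₀' (by positivity)] at hge
      have h2 : 2 * L * ‖z.2 - z.1‖ * 1 ≤ 2 * L * ‖z.2 - z.1‖ * ((n + 1) * ‖z.2 - z.1‖) :=
        mul_le_mul_of_nonneg_left h1 (by positivity)
      linarith
  have hcs1 : ∫ z, ‖z.2 - z.1‖ ∂γ ≤ √I := by
    have := integral_indicator_mul_le MeasurableSet.univ hdL fun _ => norm_nonneg _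
    simpa using this
  have hcs2 := integral_indicator_mul_le hSm hdL fun _ => norm_nonneg _
  rw [hSμ, ← hI] at hcs2
  have h3 : 2 * L * (∫ z, S.indicator (1 : Euc m × Euc m → ℝ) z * ‖z.2 - z.1‖ ∂γ) ≤
      ε / 3 * √I :=
    calc _ ≤ 2 * L * (√(μ.meas.real Aᶜ) * √I) := mul_le_mul_of_nonneg_left hcs2 (by positivity)
      _ = 2 * L * √(μ.meas.real Aᶜ) * √I := by ring
      _ ≤ _ := mul_le_mul_of_nonneg_right hn.le (Real.sqrt_nonneg _)
  have h4 : 2 * L * (n + 1) * I ≤ ε / 3 * √I := by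
    have h5 : 2 * L * (n + 1) * √I ≤ ε / 3 := by
      linarith [Real.sqrt_nonneg I]
    calc 2 * L * (n + 1) * I = 2 * L * (n + 1) * √I * √I := by
          rw [mul_assoc _ √I, Real.mul_self_sqrt hI0]
      _ ≤ _ := mul_le_mul_of_nonneg_right h5 (Real.sqrt_nonneg _)
  rw [heq, ← Real.norm_eq_abs]
  refine (norm_integral_le_of_norm_le
    (((hd.const_mul _).add (hiS.const_mul _)).add (hd2.const_mul _)) hpt).trans ?_
  rw [integral_add' ((hd.const_mul _).add (hiS.const_mul _)) (hd2.const_mul _),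
    integral_add' (hd.const_mul _) (hiS.const_mul _), integral_const_mul, integral_const_mul,
    integral_const_mul, ← hI]
  have h6 := mul_le_mul_of_nonneg_left hcs1 hε3.le
  linarith

theorem isRegularPoint_of_ae_differentiableAt (hφ : IsLocallySemiconcave φ) {μ : Pc m}
    (hμ : ∀ᵐ x ∂μ.meas, DifferentiableAt ℝ φ x) : IsRegularPoint (potential φ) μ := by
  have hα := memLp_gradient hφ μ
  have hint : ∀ ν : Pc m, ∀ γ ∈ optPlans μ.meas ν.meas,
      ∫ z, inner ℝ (hα.toLp _ z.1) (z.2 - z.1) ∂γ =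
        ∫ z, inner ℝ (gradient φ z.1) (z.2 - z.1) ∂γ := by
    intro ν γ hγ
    refine integral_congr_ae ?_
    filter_upwards [ae_fst_of_mem_plans hγ.1 hα.coeFn_toLp] with z hz
    rw [hz]
  refine ⟨⟨hα.toLp _, fun R _ ε hε => ?_⟩, ⟨hα.toLp _, fun R _ ε hε => ?_⟩⟩
  · obtain ⟨δ, hδ, h⟩ := abs_potential_sub_le hφ hμ R hε
    refine ⟨δ, hδ, fun ν hν hW => ?_⟩
    -- Existence matters here: over an empty set of plans the supremum would be `⊥`.
    obtain ⟨γ, hγ⟩ := optPlans_nonempty μ ν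
    refine le_iSup₂_of_le γ hγ (EReal.coe_le_coe_iff.2 ?_)
    rw [hint ν γ hγ]
    linarith [(abs_le.1 (h ν hν hW γ hγ)).2]
  · obtain ⟨δ, hδ, h⟩ := abs_potential_sub_le hφ hμ R hε
    refine ⟨δ, hδ, fun ν hν hW => ?_⟩
    obtain ⟨γ, hγ⟩ := optPlans_nonempty μ ν
    refine iInf₂_le_of_le γ hγ (EReal.coe_le_coe_iff.2 ?_)
    rw [hint ν γ hγ]
    linarith [(abs_le.1 (h ν hν hW γ hγ)).1]

/-! ### A nonempty subdifferential forces differentiability almost everywhere -/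

theorem le_integral_translate_of_mem_frechetSub (hφ : Continuous φ) {μ : Pc m}
    {β : Lp (Euc m) 2 μ.meas} (hβ : β ∈ frechetSub (potential φ) μ) (v : Euc m) {ε : ℝ}
    (hε : 0 < ε) :
    ∃ δ : ℝ, 0 < δ ∧ ∀ h : ℝ, 0 < h → h < δ →
      h * ∫ x, inner ℝ (β x) v ∂μ.meas ≤
        ∫ x, (φ (x + h • v) - φ x) ∂μ.meas + ε * h := by
  have hv1 : 0 < ‖v‖ + 1 := by positivity
  -- Since `W₂ = h‖v‖`, this tolerance yields an error at most `ε * h`, also when `v = 0`.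
  obtain ⟨δ, hδ, H⟩ := hβ 1 one_pos (ε / (‖v‖ + 1)) (by positivity)
  refine ⟨min δ 1 / (‖v‖ + 1), by positivity, fun h h0 hh => ?_⟩
  have hn : ‖h • v‖ = h * ‖v‖ := by rw [norm_smul, Real.norm_of_nonneg h0.le]
  rw [lt_div_iff₀ hv1] at hh
  have hlt : ‖h • v‖ < min δ 1 := by rw [hn]; linarith
  obtain ⟨γ, hγ⟩ := optPlans_nonempty μ (μ.translate (h • v))
  have hW := (optPlans_translate hγ).1
  have key := H (μ.translate (h • v))
    (translate_fattening_compl μ (hlt.trans_le (min_le_right _ _)))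
    (by rw [hW]; exact hlt.trans_le (min_le_left _ _))
  -- Every optimal plan moves mass by exactly `h • v`, so all of them give the same value and the
  -- infimum is harmless.
  have hval : ((h * ∫ x, inner ℝ (β x) v ∂μ.meas : ℝ) : EReal) ≤
      ⨅ γ ∈ optPlans μ.meas (μ.translate (h • v)).meas,
        ((∫ z, inner ℝ (β z.1) (z.2 - z.1) ∂γ : ℝ) : EReal) := by
    refine le_iInf₂ fun γ' hγ' => EReal.coe_le_coe_iff.2 (le_of_eq ?_)
    rw [← integral_const_mul, ← integral_fst_of_mem_plans hγ'.1
      (f := fun x => h * inner ℝ (β x) v)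
      (((Lp.aestronglyMeasurable β).inner_const).const_mul h)]
    refine integral_congr_ae ?_
    filter_upwards [(optPlans_translate hγ').2] with z hz
    rw [hz, inner_smul_right]
  have key := EReal.coe_le_coe_iff.1 (hval.trans key)
  rw [hW, hn, potential, potential, integral_translate μ _ hφ, ← integral_sub
    (μ.integrable (by fun_prop)) (μ.integrable hφ)] at key
  have : ε / (‖v‖ + 1) * (h * ‖v‖) ≤ ε * h := by
    rw [div_mul_eq_mul_div, div_le_iff₀ hv1]
    nlinarith [mul_pos hε h0]
  linarith

theorem ae_inner_eq_of_mem_frechetSub (hφ : IsLocallySemiconcave φ) {μ : Pc m}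
    {β : Lp (Euc m) 2 μ.meas} (hβ : β ∈ frechetSub (potential φ) μ) (v : Euc m) :
    ∀ᵐ x ∂μ.meas, ∀ p ∈ superdiff φ x, ∀ q ∈ superdiff φ x, inner ℝ p v = inner ℝ q v := by
  have hc := hφ.continuous
  obtain ⟨R, hR, hsupp, hfat⟩ := exists_ball_contains μ (‖v‖ + 1)
  obtain ⟨C, M, hC, -, hP⟩ := hφ.exists_bounded_superdiff hR
  set h : ℕ → ℝ := fun k => 1 / (k + 1) with hh
  have hpos : ∀ k, 0 < h k := fun k => by positivity
  have hlim : Tendsto h atTop (𝓝 0) := tendsto_one_div_add_atTop_nhds_zero_nat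
  have h1 : ∀ k, h k ≤ 1 := fun k => by
    rw [hh]
    exact div_le_one_of_le₀ (by simp) (by positivity)
  set g : ℕ → Euc m → ℝ := fun k x => (φ (x + h k • v) + φ (x - h k • v) - 2 * φ x) / h k
    with hg
  -- Semiconcavity makes `f k` nonnegative on the support, so its integral is its `L¹` norm.
  set f : ℕ → Euc m → ℝ := fun k x => C * ‖v‖ ^ 2 * h k - g k x with hf
  have hgi : ∀ k, Integrable (g k) μ.meas := fun k => μ.integrable (by fun_prop)
  have hfi : ∀ k, Integrable (f k) μ.meas := fun k => (integrable_const _).sub (hgi k)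
  have hf0 : ∀ k, 0 ≤ᵐ[μ.meas] f k := fun k => by
    filter_upwards [Measure.support_mem_ae (μ := μ.meas)] with x hx
    obtain ⟨p, -, hp⟩ := hP x (hsupp hx)
    have hn : ‖h k • v‖ < ‖v‖ + 1 := by
      rw [norm_smul, Real.norm_of_nonneg (hpos k).le]
      nlinarith [h1 k, norm_nonneg v]
    have a := hp (x + h k • v)
      (hfat (Set.mem_biUnion hx (by simpa [dist_eq_norm] using hn)))
    have b := hp (x - h k • v)
      (hfat (Set.mem_biUnion hx (by simpa [dist_eq_norm] using hn)))
    have e1 : x + h k • v - x = h k • v := by abel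
    have e2 : x - (x + h k • v) = -(h k • v) := by abel
    have e3 : x - h k • v - x = -(h k • v) := by abel
    have e4 : x - (x - h k • v) = h k • v := by abel
    rw [e1, e2, norm_neg, norm_smul, mul_pow, Real.norm_eq_abs, sq_abs] at a
    rw [e3, e4, inner_neg_right, norm_smul, mul_pow, Real.norm_eq_abs, sq_abs] at b
    simp only [Pi.zero_apply, hf, hg, sub_nonneg]
    rw [div_le_iff₀ (hpos k)]
    linarith
  have hint : Tendsto (fun k => ∫ x, f k x ∂μ.meas) atTop (𝓝 0) := by
    -- The subdifferential inequalities for `v` and `-v` are added, and the `β` terms cancel.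
    have hub : ∀ ε > 0, ∀ᶠ k in atTop, ∫ x, f k x ∂μ.meas ≤ C * ‖v‖ ^ 2 * h k + 2 * ε := by
      intro ε hε
      obtain ⟨δ, hδ, H⟩ := le_integral_translate_of_mem_frechetSub hc hβ v hε
      obtain ⟨δ', hδ', H'⟩ := le_integral_translate_of_mem_frechetSub hc hβ (-v) hε
      filter_upwards [hlim.eventually (gt_mem_nhds hδ), hlim.eventually (gt_mem_nhds hδ')]
        with k hk hk'
      have a := H _ (hpos k) hk
      have b := H' _ (hpos k) hk'
      simp only [inner_neg_right, integral_neg, smul_neg, ← sub_eq_add_neg] at b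
      have hsum : ∫ x, g k x ∂μ.meas = ((∫ x, (φ (x + h k • v) - φ x) ∂μ.meas) +
          ∫ x, (φ (x - h k • v) - φ x) ∂μ.meas) / h k := by
        rw [← integral_add (μ.integrable (by fun_prop)) (μ.integrable (by fun_prop)),
          ← integral_div]
        refine integral_congr_ae (ae_of_all _ fun x => ?_)
        simp only [hg]
        ring
      have hge : -(2 * ε) ≤ ∫ x, g k x ∂μ.meas := by
        rw [hsum, le_div_iff₀ (hpos k)]
        linarith
      simp only [hf]
      rw [integral_sub (integrable_const _) (hgi k)]
      simp only [integral_const, probReal_univ, one_smul]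
      linarith
    rw [Metric.tendsto_nhds]
    intro ε hε
    have hz : Tendsto (fun k => C * ‖v‖ ^ 2 * h k + 2 * (ε / 4)) atTop
        (𝓝 (C * ‖v‖ ^ 2 * 0 + 2 * (ε / 4))) := (hlim.const_mul _).add_const _
    filter_upwards [hub (ε / 4) (by positivity),
      hz.eventually (gt_mem_nhds (show _ < ε by linarith))] with k a b
    rw [Real.dist_eq, sub_zero, abs_of_nonneg (integral_nonneg_of_ae (hf0 k))]
    linarith
  have hmeas : TendstoInMeasure μ.meas f atTop (fun _ => (0 : ℝ)) := by
    refine tendstoInMeasure_of_tendsto_eLpNorm one_ne_zero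
      (fun k => (hfi k).aestronglyMeasurable) aestronglyMeasurable_const ?_
    have he : ∀ k, eLpNorm (f k - fun _ => (0 : ℝ)) 1 μ.meas =
        ENNReal.ofReal (∫ x, f k x ∂μ.meas) := fun k => by
      have : (f k - fun _ => (0 : ℝ)) = f k := by ext; simp
      rw [this, eLpNorm_one_eq_lintegral_enorm,
        ofReal_integral_eq_lintegral_ofReal (hfi k) (hf0 k)]
      refine lintegral_congr_ae ?_
      filter_upwards [hf0 k] with x hx
      exact Real.enorm_of_nonneg hx
    simp_rw [he]
    simpa [Function.comp_def] using (ENNReal.continuous_ofReal.tendsto 0).comp hint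
  obtain ⟨ns, hns, hae⟩ := hmeas.exists_seq_tendsto_ae
  filter_upwards [hae] with x hx
  have hh' : Tendsto (fun k => h (ns k)) atTop (𝓝 0) := hlim.comp hns.tendsto_atTop
  have hgx : Tendsto (fun k => g (ns k) x) atTop (𝓝 0) := by
    have := (hh'.const_mul (C * ‖v‖ ^ 2)).sub hx
    simpa [hf] using this
  have hle : ∀ p ∈ superdiff φ x, ∀ q ∈ superdiff φ x, inner ℝ q v ≤ inner ℝ p v :=
    fun p hp q hq => inner_le_of_mem_superdiff hp hq (fun k => hpos (ns k)) hh' hgx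
  exact fun p hp q hq => le_antisymm (hle q hq p hp) (hle p hp q hq)

theorem measure_singSet_of_mem_frechetSub (hφ : IsLocallySemiconcave φ) {μ : Pc m}
    {β : Lp (Euc m) 2 μ.meas} (hβ : β ∈ frechetSub (potential φ) μ) :
    μ.meas (singSet φ) = 0 := by
  -- The null set depends on `v`; finitely many basis vectors are enough to separate `p` from `q`.
  have h := ae_all_iff.2 fun i : Fin m =>
    ae_inner_eq_of_mem_frechetSub hφ hβ (EuclideanSpace.single i 1)
  have : ∀ᵐ x ∂μ.meas, x ∉ singSet φ := by
    filter_upwards [h] with x hx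
    obtain ⟨p, hp⟩ := hφ.superdiff_nonempty x
    refine not_not.2 ⟨p, Set.eq_singleton_iff_unique_mem.2 ⟨hp, fun q hq => ?_⟩⟩
    ext i
    simpa [EuclideanSpace.inner_single_right] using hx i q hq p hp
  simpa [ae_iff] using this

end WassersteinSing

end

theorem mainTheorem5 (m : ℕ) (φ : WassersteinSing.Euc m → ℝ)
    (hφ : WassersteinSing.IsLocallySemiconcave φ) (μ : WassersteinSing.Pc m) :
    (WassersteinSing.IsSingularPoint (WassersteinSing.potential φ) μ ↔
      0 < μ.meas (WassersteinSing.singSet φ)) ∧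
    (μ.meas ≪ (MeasureTheory.volume : MeasureTheory.Measure (WassersteinSing.Euc m)) →
      WassersteinSing.IsRegularPoint (WassersteinSing.potential φ) μ) := by
  have hreg : μ.meas (WassersteinSing.singSet φ) = 0 →
      WassersteinSing.IsRegularPoint (WassersteinSing.potential φ) μ := fun h => by
    refine WassersteinSing.isRegularPoint_of_ae_differentiableAt hφ ?_
    rw [hφ.singSet_eq] at h
    exact h
  refine ⟨⟨fun hs => pos_iff_ne_zero.2 fun h => hs (hreg h), fun hpos hr => ?_⟩,
    fun hac => hreg (hac hφ.volume_singSet)⟩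
  obtain ⟨β, hβ⟩ := hr.2
  exact hpos.ne' (WassersteinSing.measure_singSet_of_mem_frechetSub hφ hβ)
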